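/- Let $K$ be a field, let $n\ge 4$ be an even integer, and read all indices of variables modulo $n$. Let $S=K[x_0,\ldots,x_{n-1}]$, $R=K[y_0,\ldots,y_{n-1}]$ and $T=K[x_0,\ldots,x_{n-1},y_0,\ldots,y_{n-1}]$. Let $I=I_{n-2}(C_n)\subset S$ be the $(n-2)$-path ideal of the $n$-cycle, generated by $u_j=x_jx_{j+1}\cdots x_{j+n-3}$ for $j\in\mathbb{Z}/n$. Let $L\subset T$ be the defining ideal of the symmetric algebra of $I$, that is, the ideal generated by all linear forms $\sum_j a_jy_j$ with $a_j\in S$ and $\sum_j a_ju_j=0$. Let $H\subset R$ be the ideal of fiber relations of $I$, that is, the kernel of the $K$-algebra homomorphism $R\to K[u_j\mid j\in\mathbb{Z}/n]$, $y_j\mapsto u_j$. Put $$f_j=x_{j-2}y_j-x_jy_{j+1}\quad(1\le j\le n-1),$$ $$g_k=x_{2k-2}\prod_{\substack{0\le i<2k\\ i\text{ odd}}}y_i-x_{n-2}\prod_{\substack{0\le i<2k\\ i\text{ even}}}y_i\quad(1\le k\le n/2),\qquad h=\prod_{\substack{0\le i<n\\ i\text{ odd}}}y_i-\prod_{\substack{0\le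 i<n\\ i\text{ even}}}y_i .$$ Let $<_1$ be the (graded) reverse lexicographic order on $R$ induced by $y_1>y_2>\cdots>y_{n-1}>y_0$, let $<_2$ be an arbitrary monomial order on $S$, and let $<$ be the product order of $<_1$ and $<_2$ on $T$: two monomials of $T$ are first compared by their $y$-parts with respect to $<_1$, and ties are broken by comparing their $x$-parts with respect to $<_2$. Then $\{f_1,\ldots,f_{n-1},g_1,\ldots,g_{n/2},h\}$ is a Gröbner basis of $L+HT$ with respect to $<$: these are nonzero elements of $L+HT$, and their leading terms generate the initial ideal of $L+HT$. -/

import Mathlib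

open scoped MonomialOrder

namespace CyclePath

noncomputable section

/-! ### Monomial orders and Gröbner bases -/

/-- `m` is the (graded) reverse lexicographic order for the ordering `lt` of the variables:
`a < b` iff `deg a < deg b`, or the degrees agree and, for the smallest variable in which `a` and
`b` differ, `a` has the larger exponent. -/
def IsRevLex {σ : Type*} (lt : σ → σ → Prop) (m : MonomialOrder σ) : Prop :=
  ∀ a b : σ →₀ ℕ, a ≺[m] b ↔
    a.degree < b.degree ∨
      (a.degree = b.degree ∧ ∃ i, b i < a i ∧ ∀ j, lt j i → a j = b j)

/-- The part of an exponent in the first block of variables. -/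
def xPart {σ τ : Type*} (a : (σ ⊕ τ) →₀ ℕ) : σ →₀ ℕ :=
  a.comapDomain Sum.inl Sum.inl_injective.injOn

/-- The part of an exponent in the second block of variables. -/
def yPart {σ τ : Type*} (a : (σ ⊕ τ) →₀ ℕ) : τ →₀ ℕ :=
  a.comapDomain Sum.inr Sum.inr_injective.injOn

/-- `m` is the product order of `m₁` (on the variables `y`) and `m₂` (on the variables `x`):
the `y`-parts are compared first with `m₁`, ties are broken by comparing the `x`-parts with `m₂`. -/
def IsProductOrder {σ τ : Type*} (m : MonomialOrder (σ ⊕ τ))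
    (m₁ : MonomialOrder τ) (m₂ : MonomialOrder σ) : Prop :=
  ∀ a b : (σ ⊕ τ) →₀ ℕ, a ≺[m] b ↔
    yPart a ≺[m₁] yPart b ∨ (yPart a = yPart b ∧ xPart a ≺[m₂] xPart b)

/-- The initial ideal of `I`: the ideal generated by the leading terms of the elements of `I`. -/
def initialIdeal {σ K : Type*} [Field K] (m : MonomialOrder σ) (I : Ideal (MvPolynomial σ K)) :
    Ideal (MvPolynomial σ K) :=
  Ideal.span {t | ∃ p ∈ I, t = m.leadingTerm p}

/-- `G` is a Gröbner basis of `I`: a finite set of nonzero elements of `I` whose leading terms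
generate the initial ideal of `I`. -/
structure IsGroebnerBasis {σ K : Type*} [Field K] (m : MonomialOrder σ)
    (G : Set (MvPolynomial σ K)) (I : Ideal (MvPolynomial σ K)) : Prop where
  finite : G.Finite
  mem : ∀ g ∈ G, g ∈ I
  ne_zero : ∀ g ∈ G, g ≠ 0
  span_leadingTerm : Ideal.span {t | ∃ g ∈ G, t = m.leadingTerm g} = initialIdeal m I

/-! ### The symmetric algebra and the fiber relations of `(u₁, …, u_m)` -/

/-- The defining ideal `L` in `T = K[x, y]` of the symmetric algebra of the ideal generated by the
polynomials `u i` in `S = K[x]`: it is generated by the linear forms `∑ i, a i * y i` for all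
relations `∑ i, a i * u i = 0` with coefficients in `S`. -/
def symDefiningIdeal {σ ι K : Type*} [Fintype ι] [Field K] (u : ι → MvPolynomial σ K) :
    Ideal (MvPolynomial (σ ⊕ ι) K) :=
  Ideal.span {l | ∃ a : ι → MvPolynomial σ K, ∑ i, a i * u i = 0 ∧
    l = ∑ i, MvPolynomial.rename Sum.inl (a i) * MvPolynomial.X (Sum.inr i)}

/-- The ideal `H` of fiber relations: the kernel of `K[y] → K[u i | i]`, `y i ↦ u i`. -/
def fiberRelations {σ ι K : Type*} [Field K] (u : ι → MvPolynomial σ K) :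
    Ideal (MvPolynomial ι K) :=
  RingHom.ker (MvPolynomial.aeval u : MvPolynomial ι K →ₐ[K] MvPolynomial σ K)

/-- The extension of an ideal of `R = K[y]` to `T = K[x, y]`. -/
def extendToT {σ ι K : Type*} [Field K] (H : Ideal (MvPolynomial ι K)) :
    Ideal (MvPolynomial (σ ⊕ ι) K) :=
  H.map (MvPolynomial.rename Sum.inr : MvPolynomial ι K →ₐ[K] MvPolynomial (σ ⊕ ι) K)

/-! ### Path ideals of cycles -/

/-- The monomial `x_j x_{j+1} ⋯ x_{j+t-1}` of the `t`-path of the cycle `C_n` starting at `j`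
(indices modulo `n`); these are the generators of the `t`-path ideal `I_t(C_n)`. -/
def pathMonomial (K : Type*) [Field K] (n t : ℕ) (j : ZMod n) : MvPolynomial (ZMod n) K :=
  ∏ i ∈ Finset.range t, MvPolynomial.X (j + (i : ZMod n))

/-- The variable `x_i` of `T`, index modulo `n`. -/
def x (K : Type*) [Field K] {n : ℕ} (i : ZMod n) : MvPolynomial (ZMod n ⊕ ZMod n) K :=
  MvPolynomial.X (Sum.inl i)

/-- The variable `y_i` of `T`, index modulo `n`. -/
def y (K : Type*) [Field K] {n : ℕ} (i : ZMod n) : MvPolynomial (ZMod n ⊕ ZMod n) K :=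
  MvPolynomial.X (Sum.inr i)

/-- The representative in `{1, …, n}` of a residue class modulo `n`. -/
def rep {n : ℕ} (i : ZMod n) : ℕ := if i = 0 then n else i.val

/-- The ordering `y_1 > y_2 > ⋯ > y_{n-1} > y_n = y_0` of the variables: `varLT i j` says that
`y_i < y_j`. -/
def varLT {n : ℕ} (i j : ZMod n) : Prop := rep j < rep i

/-- The product of all `y_i` with `i` odd, `0 ≤ i < N`. -/
def oddProd (K : Type*) [Field K] (n N : ℕ) : MvPolynomial (ZMod n ⊕ ZMod n) K :=
  ∏ i ∈ (Finset.range N).filter (fun i => Odd i), y K (i : ZMod n)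

/-- The product of all `y_i` with `i` even, `0 ≤ i < N`. -/
def evenProd (K : Type*) [Field K] (n N : ℕ) : MvPolynomial (ZMod n ⊕ ZMod n) K :=
  ∏ i ∈ (Finset.range N).filter (fun i => Even i), y K (i : ZMod n)

/-- `f_j = x_{j-2} y_j - x_j y_{j+1}`. -/
def f (K : Type*) [Field K] (n j : ℕ) : MvPolynomial (ZMod n ⊕ ZMod n) K :=
  x K ((j : ZMod n) - 2) * y K (j : ZMod n) - x K (j : ZMod n) * y K ((j : ZMod n) + 1)

/-- `g_k = x_{2k-2} ∏_{i ∈ [0,2k) odd} y_i - x_{n-2} ∏_{i ∈ [0,2k) even} y_i`. -/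
def g (K : Type*) [Field K] (n k : ℕ) : MvPolynomial (ZMod n ⊕ ZMod n) K :=
  x K (2 * (k : ZMod n) - 2) * oddProd K n (2 * k)
    - x K ((n : ZMod n) - 2) * evenProd K n (2 * k)

/-- `h = ∏_{i ∈ [0,n) odd} y_i - ∏_{i ∈ [0,n) even} y_i`. -/
def h (K : Type*) [Field K] (n : ℕ) : MvPolynomial (ZMod n ⊕ ZMod n) K :=
  oddProd K n n - evenProd K n n

end

end CyclePath

/-! The ideal `L + HT` lies in the toric kernel of the Rees map `x_i ↦ x_i`, `y_j ↦ u_j t^(n-2)`, so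
the leading exponent `a` of a nonzero element has some smaller `b` in its fiber
(`exists_lt_degree_of_aeval_eq_zero`). It suffices that such an `a` is divisible by the leading
exponent of some `f_j`, `g_k` or `h`.

Let `d_j` be the difference of the `y_j`-exponents of `a` and `b`. The `d_j` sum to zero, and since
`u_j` omits exactly `x_{j-1}` and `x_{j-2}`, the `x_i`-exponents differ by `d_{i+1} + d_{i+2}`. If
`d_j > 0` and `d_{j-1} + d_j > 0` for some `1 ≤ j ≤ n-1`, then `x_{j-2} y_j` divides. Otherwise
every positive entry after `d_0` is cancelled by its predecessor, while reverse lexicographic order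
makes the last nonzero entry in the order `1, …, n-1, 0` negative. A partial-sum argument
(`exists_alternating_block`) then yields positive `d_1, d_3, …`, ending in `g_k` or `h`.

Membership: `f_j` is a binomial syzygy, the `g_k` telescope from the `f_j`, and `g_{n/2} = x_{-2} h`
with `x_{-2}` cancellable in a domain. -/

namespace CyclePath

/-! ### Integer sequences -/

/-- A positive entry is absorbed by its predecessor, which the bound by `c s` keeps available for
the next step. -/
theorem sum_range_le_min_of_pairing {n : ℕ} {c : ℕ → ℤ} (h0 : c 0 ≤ 0)
    (hc : ∀ j, j + 1 < n → 0 < c (j + 1) → c j + c (j + 1) ≤ 0) :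
    ∀ s, s < n → ∑ j ∈ Finset.range (s + 1), c j ≤ min 0 (c s) := by
  intro s
  induction s with
  | zero => intro _; simpa using h0
  | succ s ih =>
    intro hs
    have h1 := ih (by omega)
    have h2 := hc s hs
    rw [Finset.sum_range_succ]
    rw [le_min_iff] at h1 ⊢
    by_cases h : 0 < c (s + 1)
    · have := h2 h; constructor <;> linarith
    · constructor <;> linarith

/-- In a tail, only the first entry can be positive without its compensating predecessor being
present. -/
theorem sum_Ico_le_max_of_pairing {n : ℕ} {c : ℕ → ℤ}
    (hc : ∀ j, j + 1 < n → 0 < c (j + 1) → c j + c (j + 1) ≤ 0) :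
    ∀ d s, s + d + 1 = n → ∑ j ∈ Finset.Ico s n, c j ≤ max 0 (c s) := by
  intro d
  induction d with
  | zero =>
    rintro s rfl
    simp
  | succ d ih =>
    intro s hs
    have h1 := ih (s + 1) (by omega)
    have h2 := hc s (by omega)
    rw [Finset.sum_eq_sum_Ico_succ_bot (by omega)]
    rw [le_max_iff] at h1 ⊢
    by_cases h : 0 < c (s + 1)
    · have := h2 h
      left; rcases h1 with h1 | h1 <;> linarith
    · right; rcases h1 with h1 | h1 <;> linarith

/-- A sequence of sum zero whose positive entries are dominated by their predecessors, and whose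
last nonzero entry in the cyclic order `1, …, 2N - 1, 0` is negative, starts with an alternating
block. -/
theorem exists_alternating_block {N : ℕ} (hN : 1 ≤ N) {c : ℕ → ℤ}
    (hsum : ∑ j ∈ Finset.range (2 * N), c j = 0)
    (hc : ∀ j, j + 1 < 2 * N → 0 < c (j + 1) → c j + c (j + 1) ≤ 0)
    (hlast : c 0 < 0 ∨ c 0 = 0 ∧ ∃ l, l < 2 * N ∧ c l < 0 ∧ ∀ j, l < j → j < 2 * N → c j = 0) :
    ∃ k < N, (∀ i ≤ k, 0 < c (2 * i + 1)) ∧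
      (k + 1 = N ∨ k + 1 < N ∧ 0 < c (2 * k + 1) + c (2 * k + 2)) := by
  rcases hlast with h0 | ⟨h0, l, hl, hl0, hlz⟩
  · by_contra! hno
    have key : ∀ k < N, (∀ i ≤ k, 0 < c (2 * i + 1)) ∧
        ∑ j ∈ Finset.Ico (2 * k + 2) (2 * N), c j = 0 := by
      -- The tail after `2s` sums to `-c (2s) > 0` and is at most `max 0 (c (2s+1))`. With the
      -- pairing inequality this forces `c (2s+1) = -c (2s)`, so the tail from `2s+2` sums to zero
      -- again.
      have step : ∀ s, 2 * s + 2 ≤ 2 * N → ∑ j ∈ Finset.Ico (2 * s) (2 * N), c j = 0 →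
          c (2 * s) < 0 → 0 < c (2 * s + 1) ∧
            ∑ j ∈ Finset.Ico (2 * s + 2) (2 * N), c j = 0 := by
        intro s hs hz hneg
        have h1 := sum_Ico_le_max_of_pairing hc (2 * N - 2 * s - 2) (2 * s + 1) (by omega)
        rw [Finset.sum_eq_sum_Ico_succ_bot (by omega)] at hz
        have hpos : 0 < c (2 * s + 1) := by
          by_contra hle
          rw [max_eq_left (by linarith)] at h1
          linarith
        rw [max_eq_right hpos.le] at h1
        have h3 := hc (2 * s) (by omega) hpos
        refine ⟨hpos, ?_⟩
        rw [Finset.sum_eq_sum_Ico_succ_bot (a := 2 * s + 1) (by omega)] at hz h1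
        rw [show 2 * s + 1 + 1 = 2 * s + 2 from rfl] at hz h1
        linarith
      intro k
      induction k with
      | zero =>
        intro hk
        have := step 0 (by omega) (by simpa using hsum) (by simpa using h0)
        refine ⟨fun i hi => ?_, this.2⟩
        obtain rfl : i = 0 := by omega
        exact this.1
      | succ k ih =>
        intro hk
        obtain ⟨h1, h2⟩ := ih (by omega)
        have h3 := (hno k (by omega) h1).2 hk
        have := step (k + 1) (by omega) h2 (by
          have := h1 k le_rfl
          rw [show 2 * (k + 1) = 2 * k + 2 by ring]; linarith)
        refine ⟨fun i hi => ?_, this.2⟩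
        rcases Nat.lt_or_ge i (k + 1) with h | h
        · exact h1 i (by omega)
        · obtain rfl : i = k + 1 := by omega
          exact this.1
    exact (hno (N - 1) (by omega) (key (N - 1) (by omega)).1).1 (by omega)
  · exfalso
    -- The sum up to the last nonzero entry is at most that negative entry, so the total cannot
    -- vanish.
    have h1 := (le_min_iff.1 (sum_range_le_min_of_pairing h0.le hc l hl)).2
    rw [← Finset.sum_range_add_sum_Ico c (show l + 1 ≤ 2 * N by omega),
      Finset.sum_eq_zero (s := Finset.Ico (l + 1) (2 * N))] at hsum
    · linarith
    · intro j hj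
      rw [Finset.mem_Ico] at hj
      exact hlz j (by omega) hj.2

noncomputable section

/-! ### Relations between the path monomials -/

open MvPolynomial

theorem natCast_sub_two {n : ℕ} (hn : 2 ≤ n) : ((n - 2 : ℕ) : ZMod n) = -2 := by
  rw [Nat.cast_sub hn]; simp

/-- Both sides are the monomial of the `(n-1)`-path starting at `j`, whose last vertex is `j + n - 2
= j - 2`. -/
theorem X_mul_pathMonomial (K : Type*) [Field K] {n : ℕ} (hn : 2 ≤ n) (j : ZMod n) :
    X (j - 2) * pathMonomial K n (n - 2) j = X j * pathMonomial K n (n - 2) (j + 1) := by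
  have h1 := Finset.prod_range_succ
    (fun i : ℕ => (X (j + (i : ZMod n)) : MvPolynomial (ZMod n) K)) (n - 2)
  have h2 := Finset.prod_range_succ'
    (fun i : ℕ => (X (j + (i : ZMod n)) : MvPolynomial (ZMod n) K)) (n - 2)
  rw [natCast_sub_two hn, ← sub_eq_add_neg] at h1
  rw [h1] at h2
  simp only [pathMonomial]
  rw [mul_comm, h2, Nat.cast_zero, add_zero, mul_comm]
  congr 1
  refine Finset.prod_congr rfl fun i _ => ?_
  rw [Nat.cast_succ, add_assoc, add_comm (i : ZMod n) 1]

variable (K : Type*) [Field K]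

theorem sub_mem_symDefiningIdeal {σ ι : Type*} [Fintype ι] {u : ι → MvPolynomial σ K}
    {p q : MvPolynomial σ K} {i j : ι} (h : p * u i = q * u j) :
    rename Sum.inl p * X (Sum.inr i) - rename Sum.inl q * X (Sum.inr j) ∈
      symDefiningIdeal u := by
  classical
  refine Ideal.subset_span ⟨Pi.single i p - Pi.single j q, ?_, ?_⟩
  · simp [sub_mul, Finset.sum_sub_distrib, Pi.single_apply, h]
  · simp only [Pi.sub_apply, map_sub, sub_mul, Finset.sum_sub_distrib]
    congr 1
    · rw [Finset.sum_eq_single i] <;> simp +contextual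
    · rw [Finset.sum_eq_single j] <;> simp +contextual

variable {n : ℕ}

theorem f_mem [NeZero n] (hn : 2 ≤ n) (j : ℕ) :
    f K n j ∈ symDefiningIdeal (pathMonomial K n (n - 2)) := by
  have := sub_mem_symDefiningIdeal K (X_mul_pathMonomial K hn (j : ZMod n))
  simpa [f, x, y] using this

theorem oddProd_two_mul (n k : ℕ) :
    oddProd K n (2 * k) = ∏ i ∈ Finset.range k, y K (((2 * i + 1 : ℕ) : ZMod n)) := by
  induction k with
  | zero => simp [oddProd]
  | succ k ih =>
    rw [Finset.prod_range_succ, ← ih, oddProd, oddProd, show 2 * (k + 1) = 2 * k + 1 + 1 by ring,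
      Finset.range_add_one, Finset.filter_insert, if_pos (by simp), Finset.range_add_one,
      Finset.filter_insert, if_neg (by simp), Finset.prod_insert (by simp), mul_comm]

theorem evenProd_two_mul (n k : ℕ) :
    evenProd K n (2 * k) = ∏ i ∈ Finset.range k, y K (((2 * i : ℕ) : ZMod n)) := by
  induction k with
  | zero => simp [evenProd]
  | succ k ih =>
    rw [Finset.prod_range_succ, ← ih, evenProd, evenProd, show 2 * (k + 1) = 2 * k + 1 + 1 by ring,
      Finset.range_add_one, Finset.filter_insert, if_neg (by simp), Finset.range_add_one,
      Finset.filter_insert, if_pos (by simp), Finset.prod_insert (by simp), mul_comm]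

theorem g_one (n : ℕ) : g K n 1 = - f K n n := by
  have h1 := oddProd_two_mul K n 1
  have h2 := evenProd_two_mul K n 1
  simp only [mul_one] at h1 h2
  simp [g, f, h1, h2]

theorem g_succ (n k : ℕ) :
    g K n (k + 1) = y K ((2 * k : ℕ) : ZMod n) * g K n k - oddProd K n (2 * k) * f K n (2 * k) := by
  simp only [g, f, oddProd_two_mul, evenProd_two_mul, Finset.prod_range_succ]
  push_cast
  rw [show (2 * ((k : ZMod n) + 1) - 2) = 2 * k by ring]
  ring

theorem g_mem [NeZero n] (hn : 2 ≤ n) (k : ℕ) :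
    g K n (k + 1) ∈ symDefiningIdeal (pathMonomial K n (n - 2)) := by
  induction k with
  | zero => rw [zero_add, g_one]; exact neg_mem (f_mem K hn n)
  | succ k ih =>
    rw [g_succ]
    exact sub_mem (Ideal.mul_mem_left _ _ ih) (Ideal.mul_mem_left _ _ (f_mem K hn _))

/-- Linear relations survive a common factor `c` on the `y_i`. Taking `c = 1` gives the evaluation
`y_j ↦ u_j`, and `c = t^(n-2)` the Rees map. -/
theorem aeval_elim_eq_zero_of_mem_symDefiningIdeal {σ ι A : Type*} [Fintype ι] [CommRing A]
    [Algebra K A] {u : ι → MvPolynomial σ K} (φ : MvPolynomial (σ ⊕ ι) K →ₐ[K] A) (c : A)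
    (hφ : ∀ i, φ (X (Sum.inr i)) = φ (rename Sum.inl (u i)) * c) :
    symDefiningIdeal u ≤ RingHom.ker φ := by
  refine Ideal.span_le.2 ?_
  rintro _ ⟨a, ha, rfl⟩
  have : φ (rename Sum.inl (∑ i, a i * u i)) * c = 0 := by rw [ha]; simp
  simp only [SetLike.mem_coe, RingHom.mem_ker, map_sum, map_mul, hφ]
  rw [← this]
  simp only [map_sum, map_mul, Finset.sum_mul, mul_assoc]

theorem g_half {N : ℕ} (hnN : n = 2 * N) : g K n N = x K (-2) * h K n := by
  have : 2 * (N : ZMod n) = 0 := by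
    have := ZMod.natCast_self n
    rw [hnN] at this ⊢
    exact_mod_cast this
  have h2 : oddProd K n (2 * N) = oddProd K n n := by rw [← hnN]
  have h3 : evenProd K n (2 * N) = evenProd K n n := by rw [← hnN]
  rw [g, h, h2, h3, this, ZMod.natCast_self, zero_sub, mul_sub]

theorem h_mem [NeZero n] (hn : 2 ≤ n) (hn_even : Even n) :
    h K n ∈ extendToT (fiberRelations (pathMonomial K n (n - 2))) := by
  obtain ⟨N, hN⟩ := hn_even
  rw [← two_mul] at hN
  let q : MvPolynomial (ZMod n) K :=
    ∏ i ∈ (Finset.range n).filter (fun i => Odd i), X (i : ZMod n) -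
      ∏ i ∈ (Finset.range n).filter (fun i => Even i), X (i : ZMod n)
  have hq : h K n = rename Sum.inr q := by
    simp [q, h, oddProd, evenProd, y, map_prod]
  rw [hq]
  refine Ideal.mem_map_of_mem _ ?_
  let φ : MvPolynomial (ZMod n ⊕ ZMod n) K →ₐ[K] MvPolynomial (ZMod n) K :=
    aeval (Sum.elim X (pathMonomial K n (n - 2)))
  -- The relation `h` is checked on the `u_j` indirectly: `φ` kills `g_N = x_{-2} h`, and the image
  -- of `x_{-2}` is a nonzero variable of a domain.
  have hφ : φ (g K n N) = 0 := by
    have := aeval_elim_eq_zero_of_mem_symDefiningIdeal K (u := pathMonomial K n (n - 2)) φ 1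
      (fun i => by
        simp only [φ]
        rw [aeval_rename, Sum.elim_comp_inl, aeval_X, aeval_X_left_apply, mul_one, Sum.elim_inr])
    obtain ⟨k, rfl⟩ : ∃ k, N = k + 1 := ⟨N - 1, by omega⟩
    exact this (g_mem K hn k)
  have h2 : φ (rename Sum.inr q) = aeval (pathMonomial K n (n - 2)) q := by
    simp only [φ]
    rw [aeval_rename, Sum.elim_comp_inr]
  rw [g_half K hN, map_mul, hq, h2] at hφ
  refine (mul_eq_zero.1 hφ).resolve_left ?_
  simp [φ, x]

end

noncomputable section

open MvPolynomial

/-! ### Monomial substitutions -/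

theorem aeval_monomial_one_monomial {σ τ K : Type*} [Fintype σ] [Field K] (w : σ → τ →₀ ℕ)
    (a : σ →₀ ℕ) (c : K) :
    aeval (fun v => (monomial (w v) 1 : MvPolynomial τ K)) (monomial a c) =
      monomial (∑ v, a v • w v) c := by
  rw [aeval_monomial, monomial_sum_index, Finsupp.prod_fintype _ _ (fun _ => pow_zero _)]
  simp [monomial_pow, algebraMap_eq]

/-- The leading exponent of a nonzero element of a toric ideal is not minimal in its fiber. -/
theorem exists_lt_degree_of_aeval_eq_zero {σ τ K : Type*} [Fintype σ] [Field K]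
    (m : MonomialOrder σ) (w : σ → τ →₀ ℕ) {p : MvPolynomial σ K} (hp : p ≠ 0)
    (h0 : aeval (fun v => (monomial (w v) 1 : MvPolynomial τ K)) p = 0) :
    ∃ b, b ≺[m] m.degree p ∧ ∑ v, b v • w v = ∑ v, m.degree p v • w v := by
  classical
  by_contra! hno
  -- If no smaller exponent shared the fiber of the leading one, the leading coefficient would
  -- survive uncancelled in the image.
  have h1 : coeff (∑ v, m.degree p v • w v)
      (aeval (fun v => (monomial (w v) 1 : MvPolynomial τ K)) p) = p.coeff (m.degree p) := by
    conv_lhs => rw [congrArg (aeval _) p.as_sum]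
    simp only [map_sum, aeval_monomial_one_monomial, coeff_sum, coeff_monomial]
    rw [Finset.sum_eq_single (m.degree p)]
    · simp
    · intro b hb hne
      refine if_neg (hno b ?_)
      exact lt_of_le_of_ne (m.le_degree hb) (fun h => hne (m.toSyn.injective h))
    · intro h
      exact absurd (m.degree_mem_support hp) h
  rw [h0, coeff_zero] at h1
  exact m.coeff_degree_ne_zero_iff.2 hp h1.symm

theorem leadingTerm_mem_span_of_le {σ K : Type*} [Field K] (m : MonomialOrder σ)
    {G : Set (MvPolynomial σ K)} {p q : MvPolynomial σ K} (hq : q ∈ G)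
    (hlc : m.leadingCoeff q = 1) (hle : m.degree q ≤ m.degree p) :
    m.leadingTerm p ∈ Ideal.span {t | ∃ g ∈ G, t = m.leadingTerm g} := by
  have : m.leadingTerm p =
      monomial (m.degree p - m.degree q) (m.leadingCoeff p) * m.leadingTerm q := by
    rw [MonomialOrder.leadingTerm, MonomialOrder.leadingTerm, monomial_mul, hlc, mul_one,
      tsub_add_cancel_of_le hle]
  rw [this]
  exact Ideal.mul_mem_left _ _ (Ideal.subset_span ⟨q, hq, rfl⟩)

theorem degree_monomial_sub_monomial {σ K : Type*} [Field K] (m : MonomialOrder σ)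
    {a b : σ →₀ ℕ} (hab : b ≺[m] a) :
    m.degree (monomial a (1 : K) - monomial b 1) = a ∧
      m.leadingCoeff (monomial a (1 : K) - monomial b 1) = 1 := by
  classical
  have h : m.degree (monomial b (1 : K)) ≺[m] m.degree (monomial a (1 : K)) := by
    simpa [MonomialOrder.degree_monomial] using hab
  rw [m.degree_sub_of_lt h, m.leadingCoeff_sub_of_lt h]
  simp [MonomialOrder.degree_monomial]

/-! ### The Rees map of the path ideal -/

/-- The exponent of `pathMonomial`. -/
def pathExp (n t : ℕ) (j : ZMod n) : ZMod n →₀ ℕ :=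
  ∑ i ∈ Finset.range t, Finsupp.single (j + (i : ZMod n)) 1

/-- The exponents of the images of the variables under `x i ↦ x i`, `y j ↦ u j * t ^ (n - 2)`. -/
def reesExp (n : ℕ) : ZMod n ⊕ ZMod n → Option (ZMod n) →₀ ℕ :=
  Sum.elim (fun i => Finsupp.single (some i) 1)
    (fun j => (pathExp n (n - 2) j).mapDomain some + Finsupp.single none (n - 2))

theorem pathMonomial_eq (K : Type*) [Field K] (n t : ℕ) (j : ZMod n) :
    pathMonomial K n t j = monomial (pathExp n t j) 1 := by
  rw [pathExp, monomial_sum_one]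
  rfl

/-- Extending the path by the two missing vertices `j - 2` and `j - 1` covers the cycle exactly
once. The additive form avoids truncated subtraction. -/
theorem pathExp_apply_add {n : ℕ} [NeZero n] (hn : 2 ≤ n) (j i : ZMod n) :
    pathExp n (n - 2) j i + ((if j = i + 1 then 1 else 0) + (if j = i + 2 then 1 else 0)) = 1 := by
  have hfull : pathExp n (n - 2 + 1 + 1) j i = 1 := by
    rw [show n - 2 + 1 + 1 = n by omega, pathExp, Finsupp.finsetSum_apply,
      Finset.sum_eq_single (i - j).val]
    · simp
    · intro t ht hne
      rw [Finsupp.single_apply, if_neg]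
      rintro rfl
      apply hne
      rw [add_sub_cancel_left, ZMod.val_cast_of_lt (Finset.mem_range.1 ht)]
    · intro h
      exact absurd (Finset.mem_range.2 (ZMod.val_lt _)) h
  rw [pathExp, Finset.sum_range_succ, Finset.sum_range_succ] at hfull
  rw [Nat.cast_succ, natCast_sub_two hn] at hfull
  simp only [Finsupp.add_apply, Finsupp.single_apply] at hfull
  refine Eq.trans ?_ hfull
  rw [pathExp, add_assoc, add_comm (ite (j = i + 1) 1 0)]
  congr 2
  · exact if_congr ⟨by rintro rfl; ring, by rintro rfl; ring⟩ rfl rfl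
  · exact if_congr ⟨by rintro rfl; ring, by rintro rfl; ring⟩ rfl rfl

section

variable (K : Type*) [Field K]

/-- The map `x i ↦ x i`, `y j ↦ u j * t ^ (n - 2)`, whose kernel is the Rees ideal. -/
def reesMap (n : ℕ) : MvPolynomial (ZMod n ⊕ ZMod n) K →ₐ[K] MvPolynomial (Option (ZMod n)) K :=
  aeval fun v => monomial (reesExp n v) 1

theorem reesMap_rename_inl (n : ℕ) (p : MvPolynomial (ZMod n) K) :
    reesMap K n (rename Sum.inl p) = rename some p := by
  have h : (reesMap K n).comp (rename Sum.inl) = rename some := by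
    refine algHom_ext fun i => ?_
    rw [AlgHom.comp_apply, rename_X, rename_X, reesMap, aeval_X]
    rfl
  exact DFunLike.congr_fun h p

theorem reesMap_inr (n : ℕ) (j : ZMod n) :
    reesMap K n (X (Sum.inr j)) =
      rename some (pathMonomial K n (n - 2) j) * X none ^ (n - 2) := by
  rw [reesMap, aeval_X, pathMonomial_eq, rename_monomial, X_pow_eq_monomial, monomial_mul, mul_one]
  rfl

theorem sup_le_ker_reesMap (n : ℕ) [NeZero n] :
    symDefiningIdeal (pathMonomial K n (n - 2)) ⊔
      extendToT (fiberRelations (pathMonomial K n (n - 2))) ≤ RingHom.ker (reesMap K n) := by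
  refine sup_le (aeval_elim_eq_zero_of_mem_symDefiningIdeal K _ (X none ^ (n - 2)) fun j => ?_) ?_
  · rw [reesMap_inr, reesMap_rename_inl]
  · refine Ideal.map_le_iff_le_comap.2 fun p hp => ?_
    -- Each `u_j` has degree `n - 2`, so `x_i ↦ x_i t` turns it into `u_j t^(n-2)`. Hence the Rees
    -- map on `R` factors through `y_j ↦ u_j`; this is why the exponent of `t` is `n - 2`.
    let ψ : MvPolynomial (ZMod n) K →ₐ[K] MvPolynomial (Option (ZMod n)) K :=
      aeval fun i => X (some i) * X none
    have h1 : (reesMap K n).comp (rename Sum.inr) = ψ.comp (aeval (pathMonomial K n (n - 2))) := by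
      refine algHom_ext fun j => ?_
      rw [AlgHom.comp_apply, AlgHom.comp_apply, rename_X, reesMap_inr, aeval_X]
      simp [ψ, pathMonomial, map_prod, Finset.prod_mul_distrib]
    have h2 := DFunLike.congr_fun h1 p
    rw [AlgHom.comp_apply, AlgHom.comp_apply,
      show aeval (pathMonomial K n (n - 2)) p = 0 from hp, map_zero] at h2
    exact h2

end

theorem sum_smul_reesExp_some {n : ℕ} [NeZero n] (hn : 2 ≤ n) (a : (ZMod n ⊕ ZMod n) →₀ ℕ)
    (i : ZMod n) :
    (∑ v, a v • reesExp n v) (some i) + (a (Sum.inr (i + 1)) + a (Sum.inr (i + 2))) =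
      a (Sum.inl i) + ∑ j, a (Sum.inr j) := by
  rw [Finsupp.finsetSum_apply, Fintype.sum_sum_type]
  have h1 : ∀ j : ZMod n, (a (Sum.inr j) • reesExp n (Sum.inr j)) (some i) =
      a (Sum.inr j) * pathExp n (n - 2) j i := by
    intro j
    simp [reesExp, Finsupp.mapDomain_apply (Option.some_injective _)]
  have h2 : ∑ j : ZMod n, (a (Sum.inl j) • reesExp n (Sum.inl j)) (some i) = a (Sum.inl i) := by
    rw [Finset.sum_eq_single i] <;> simp +contextual [reesExp]
  have h3 : a (Sum.inr (i + 1)) + a (Sum.inr (i + 2)) = ∑ j : ZMod n,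
      a (Sum.inr j) * ((if j = i + 1 then 1 else 0) + (if j = i + 2 then 1 else 0)) := by
    simp [mul_add, Finset.sum_add_distrib]
  rw [h2, h3, add_assoc, ← Finset.sum_add_distrib]
  congr 1
  refine Finset.sum_congr rfl fun j _ => ?_
  rw [h1, ← mul_add, pathExp_apply_add hn, mul_one]

theorem sum_smul_reesExp_none {n : ℕ} [NeZero n] (a : (ZMod n ⊕ ZMod n) →₀ ℕ) :
    (∑ v, a v • reesExp n v) none = (∑ j, a (Sum.inr j)) * (n - 2) := by
  rw [Finsupp.finsetSum_apply, Fintype.sum_sum_type, Finset.sum_mul]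
  have h1 : ∀ j : ZMod n, (pathExp n (n - 2) j).mapDomain some none = 0 := fun j =>
    Finsupp.mapDomain_of_notMem_range _ _ (by simp)
  simp [reesExp, h1]

/-! ### Comparing exponents -/

theorem rep_natCast {n j : ℕ} (h1 : 1 ≤ j) (hj : j ≤ n) : rep (j : ZMod n) = j := by
  rcases hj.lt_or_eq with h | rfl
  · have : (j : ZMod n) ≠ 0 := by
      rw [Ne, ZMod.natCast_eq_zero_iff]
      exact Nat.not_dvd_of_pos_of_lt h1 h
    rw [rep, if_neg this, ZMod.val_cast_of_lt h]
  · simp [rep]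

theorem rep_le {n : ℕ} [NeZero n] (i : ZMod n) : rep i ≤ n := by
  rw [rep]; split_ifs
  · exact le_rfl
  · exact (ZMod.val_lt i).le

theorem one_le_rep {n : ℕ} [NeZero n] (i : ZMod n) : 1 ≤ rep i := by
  rw [rep]; split_ifs with h
  · exact NeZero.one_le
  · exact Nat.one_le_iff_ne_zero.2 ((ZMod.val_ne_zero i).2 h)

theorem natCast_rep {n : ℕ} [NeZero n] (i : ZMod n) : ((rep i : ℕ) : ZMod n) = i := by
  rw [rep]; split_ifs with h
  · simp [h]
  · simp

/-- The exponent of `x_{j-2} y_j`. -/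
def fExp (n j : ℕ) : (ZMod n ⊕ ZMod n) →₀ ℕ :=
  Finsupp.single (Sum.inl ((j : ZMod n) - 2)) 1 + Finsupp.single (Sum.inr (j : ZMod n)) 1

/-- The exponent of `∏_{i < k} y_{2i + e}`. -/
def stepExp (n k e : ℕ) : (ZMod n ⊕ ZMod n) →₀ ℕ :=
  ∑ i ∈ Finset.range k, Finsupp.single (Sum.inr ((2 * i + e : ℕ) : ZMod n)) 1

theorem yPart_apply {σ τ : Type*} (a : (σ ⊕ τ) →₀ ℕ) (j : τ) : yPart a j = a (Sum.inr j) := rfl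

theorem xPart_apply {σ τ : Type*} (a : (σ ⊕ τ) →₀ ℕ) (j : σ) : xPart a j = a (Sum.inl j) := rfl

theorem degree_yPart {σ τ : Type*} [Fintype τ] (a : (σ ⊕ τ) →₀ ℕ) :
    (yPart a).degree = ∑ j, a (Sum.inr j) := by
  rw [Finsupp.degree_eq_sum]; rfl

theorem monomial_stepExp (K : Type*) [Field K] (n k e : ℕ) :
    (monomial (stepExp n k e) 1 : MvPolynomial _ K) =
      ∏ i ∈ Finset.range k, y K ((2 * i + e : ℕ) : ZMod n) := by
  rw [stepExp, monomial_sum_one]; rfl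

theorem stepExp_inl (n k e : ℕ) (i : ZMod n) : stepExp n k e (Sum.inl i) = 0 := by
  simp [stepExp, Finsupp.finsetSum_apply]

theorem sum_stepExp (n k e : ℕ) [NeZero n] : ∑ j : ZMod n, stepExp n k e (Sum.inr j) = k := by
  simp only [stepExp, Finsupp.finsetSum_apply]
  rw [Finset.sum_comm]
  simp [Finsupp.single_apply]

/-- The bound on `k` keeps the indices `2i + e` below `n`, hence distinct modulo `n`, so the product
is squarefree. -/
theorem stepExp_le {n k e : ℕ} (hk : 2 * k + e ≤ n + 1) {a : (ZMod n ⊕ ZMod n) →₀ ℕ}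
    (ha : ∀ i < k, 0 < a (Sum.inr ((2 * i + e : ℕ) : ZMod n))) : stepExp n k e ≤ a := by
  intro v
  rcases v with v | v
  · simp [stepExp_inl]
  · rw [stepExp, Finsupp.finsetSum_apply]
    by_cases hv : ∃ i < k, ((2 * i + e : ℕ) : ZMod n) = v
    · obtain ⟨i, hi, rfl⟩ := hv
      rw [Finset.sum_eq_single i]
      · simpa [Nat.one_le_iff_ne_zero, Nat.pos_iff_ne_zero] using ha i hi
      · intro t ht hne
        rw [Finsupp.single_apply, if_neg]
        intro h
        rw [Sum.inr.injEq, ZMod.natCast_eq_natCast_iff'] at h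
        rw [Finset.mem_range] at ht
        rw [Nat.mod_eq_of_lt (by omega), Nat.mod_eq_of_lt (by omega)] at h
        omega
      · intro h
        exact absurd (Finset.mem_range.2 hi) h
    · push Not at hv
      rw [Finset.sum_eq_zero]
      · exact Nat.zero_le _
      · intro t ht
        rw [Finsupp.single_apply, if_neg]
        intro h
        exact hv t (Finset.mem_range.1 ht) (Sum.inr.inj h)

theorem single_inl_add_le {σ τ : Type*} {i : σ} {a b : (σ ⊕ τ) →₀ ℕ} (hi : 0 < a (Sum.inl i))
    (hb : b ≤ a) (hbi : b (Sum.inl i) = 0) : Finsupp.single (Sum.inl i) 1 + b ≤ a := by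
  classical
  intro v
  rw [Finsupp.add_apply, Finsupp.single_apply]
  split_ifs with h
  · subst h; omega
  · simpa using hb v

end

open MvPolynomial

/-! ### Leading exponents and divisibility within fibers -/

section LeadingTerms

variable {K : Type*} [Field K] {n : ℕ} [NeZero n] {m₁ m₂ : MonomialOrder (ZMod n)}
  {m : MonomialOrder (ZMod n ⊕ ZMod n)}

omit [NeZero n] in
theorem natCast_ne_zero_of_lt {j : ℕ} (h1 : 1 ≤ j) (hj : j < n) : (j : ZMod n) ≠ 0 := by
  rw [Ne, ZMod.natCast_eq_zero_iff]
  exact Nat.not_dvd_of_pos_of_lt h1 hj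

theorem lt_of_yPart_revLex (hm₁ : IsRevLex varLT m₁) (hm : IsProductOrder m m₁ m₂)
    {a b : (ZMod n ⊕ ZMod n) →₀ ℕ} (i : ZMod n)
    (hdeg : ∑ j, a (Sum.inr j) = ∑ j, b (Sum.inr j)) (hi : b (Sum.inr i) < a (Sum.inr i))
    (hj : ∀ j, rep i < rep j → a (Sum.inr j) = b (Sum.inr j)) : a ≺[m] b := by
  refine (hm a b).2 (Or.inl ((hm₁ _ _).2 (Or.inr ⟨?_, i, hi, hj⟩)))
  rwa [degree_yPart, degree_yPart]

theorem degree_f (hm₁ : IsRevLex varLT m₁) (hm : IsProductOrder m m₁ m₂) {j : ℕ} (h1 : 1 ≤ j)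
    (hj : j ≤ n - 1) :
    m.degree (f K n j) = fExp n j ∧ m.leadingCoeff (f K n j) = 1 := by
  classical
  have hf : f K n j = monomial (fExp n j) 1 - monomial (Finsupp.single (Sum.inl (j : ZMod n)) 1 +
      Finsupp.single (Sum.inr ((j : ZMod n) + 1)) 1) 1 := by
    simp only [f, fExp, x, y, X, monomial_mul, mul_one]
  have hr : rep ((j : ZMod n) + 1) = j + 1 := by
    rw [← Nat.cast_succ]
    exact rep_natCast (by omega) (by omega)
  have hr' : rep (j : ZMod n) = j := rep_natCast h1 (by omega)
  rw [hf]
  refine degree_monomial_sub_monomial m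
    (lt_of_yPart_revLex hm₁ hm ((j : ZMod n) + 1) ?_ ?_ fun l hl => ?_)
  · simp [fExp, Finsupp.single_apply]
  · have : (j : ZMod n) ≠ j + 1 := fun h => by
      have := congrArg rep h
      omega
    simp [fExp, this]
  · have h2 : (j : ZMod n) ≠ l := by rintro rfl; omega
    have h3 : (j : ZMod n) + 1 ≠ l := by rintro rfl; omega
    simp [fExp, h2, h3]

omit [NeZero n] in
theorem stepExp_zero_apply_zero {k : ℕ} (hk : 1 ≤ k) : 0 < stepExp n k 0 (Sum.inr 0) := by
  rw [stepExp, Finsupp.finsetSum_apply]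
  refine Finset.sum_pos' (fun _ _ => Nat.zero_le _) ⟨0, Finset.mem_range.2 hk, ?_⟩
  simp

omit [NeZero n] in
theorem stepExp_one_apply_zero {k : ℕ} (hk : 2 * k ≤ n) : stepExp n k 1 (Sum.inr 0) = 0 := by
  rw [stepExp, Finsupp.finsetSum_apply]
  refine Finset.sum_eq_zero fun i hi => ?_
  rw [Finset.mem_range] at hi
  rw [Finsupp.single_apply, if_neg]
  rw [Sum.inr.injEq]
  exact natCast_ne_zero_of_lt (by omega) (by omega)

theorem not_rep_zero_lt (l : ZMod n) : ¬ rep (0 : ZMod n) < rep l := by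
  have := rep_le l
  simpa [rep] using this

theorem degree_g (hm₁ : IsRevLex varLT m₁) (hm : IsProductOrder m m₁ m₂) {k : ℕ} (h1 : 1 ≤ k)
    (hk : 2 * k ≤ n) :
    m.degree (g K n k) = Finsupp.single (Sum.inl (2 * (k : ZMod n) - 2)) 1 + stepExp n k 1 ∧
      m.leadingCoeff (g K n k) = 1 := by
  classical
  have hg : g K n k = monomial (Finsupp.single (Sum.inl (2 * (k : ZMod n) - 2)) 1 + stepExp n k 1) 1
      - monomial (Finsupp.single (Sum.inl ((n : ZMod n) - 2)) 1 + stepExp n k 0) 1 := by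
    have h0 := monomial_stepExp K n k 0
    simp only [add_zero] at h0
    rw [g, oddProd_two_mul, evenProd_two_mul, ← monomial_stepExp K n k 1, ← h0]
    simp only [x, X, monomial_mul, mul_one]
  rw [hg]
  refine degree_monomial_sub_monomial m (lt_of_yPart_revLex hm₁ hm 0 ?_ ?_ fun l hl => ?_)
  · simp [sum_stepExp]
  · simp [stepExp_one_apply_zero hk, stepExp_zero_apply_zero h1]
  · exact absurd hl (not_rep_zero_lt l)

theorem degree_h (hm₁ : IsRevLex varLT m₁) (hm : IsProductOrder m m₁ m₂) {N : ℕ} (h1 : 1 ≤ N)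
    (hN : n = 2 * N) :
    m.degree (h K n) = stepExp n N 1 ∧ m.leadingCoeff (h K n) = 1 := by
  have hh : h K n = monomial (stepExp n N 1) 1 - monomial (stepExp n N 0) 1 := by
    have h2 := oddProd_two_mul K n N
    have h3 := evenProd_two_mul K n N
    rw [← hN] at h2 h3
    rw [h, h2, h3, monomial_stepExp, monomial_stepExp]
    rfl
  rw [hh]
  refine degree_monomial_sub_monomial m (lt_of_yPart_revLex hm₁ hm 0 ?_ ?_ fun l hl => ?_)
  · simp [sum_stepExp]
  · rw [stepExp_one_apply_zero hN.ge]
    exact stepExp_zero_apply_zero h1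
  · exact absurd hl (not_rep_zero_lt l)

/-- An exponent that is not minimal in its fiber under the Rees map is divisible by the leading
exponent of some `f j`, `g k` or `h`. -/
theorem exists_le_of_lt_of_fiber (hm₁ : IsRevLex varLT m₁) (hm : IsProductOrder m m₁ m₂)
    (hn : 3 ≤ n) {N : ℕ} (hN : n = 2 * N) {a b : (ZMod n ⊕ ZMod n) →₀ ℕ} (hba : b ≺[m] a)
    (hD : ∑ v, b v • reesExp n v = ∑ v, a v • reesExp n v) :
    (∃ j, 1 ≤ j ∧ j ≤ n - 1 ∧ fExp n j ≤ a) ∨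
      (∃ k, 1 ≤ k ∧ k ≤ N ∧
        Finsupp.single (Sum.inl (2 * (k : ZMod n) - 2)) 1 + stepExp n k 1 ≤ a) ∨
      stepExp n N 1 ≤ a := by
  have hsum : ∑ j : ZMod n, b (Sum.inr j) = ∑ j : ZMod n, a (Sum.inr j) := by
    have := DFunLike.congr_fun hD none
    rw [sum_smul_reesExp_none, sum_smul_reesExp_none] at this
    exact Nat.eq_of_mul_eq_mul_right (by omega) this
  let d : ZMod n → ℤ := fun j => a (Sum.inr j) - b (Sum.inr j)
  have hx : ∀ i : ZMod n, (a (Sum.inl i) : ℤ) - b (Sum.inl i) = d (i + 1) + d (i + 2) := by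
    intro i
    have h1 := sum_smul_reesExp_some (by omega) a i
    have h2 := sum_smul_reesExp_some (by omega) b i
    rw [hD] at h2
    simp only [d]
    omega
  have hd : ∀ j, 0 < d j → 0 < a (Sum.inr j) := fun j hj => by
    simp only [d] at hj; omega
  have hxpos : ∀ i : ZMod n, 0 < d (i + 1) + d (i + 2) → 0 < a (Sum.inl i) := fun i hi => by
    have := hx i; omega
  by_cases hf : ∃ j : ℕ, j + 1 < n ∧ 0 < d ((j + 1 : ℕ) : ZMod n) ∧
      0 < d (j : ZMod n) + d ((j + 1 : ℕ) : ZMod n)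
  · obtain ⟨j, hj, h1, h2⟩ := hf
    refine Or.inl ⟨j + 1, by omega, by omega, single_inl_add_le (hxpos _ ?_) ?_ ?_⟩
    · push_cast at h2 ⊢
      convert h2 using 3 <;> ring
    · rw [Finsupp.single_le_iff]
      exact hd _ h1
    · simp
  push Not at hf
  right
  have hNpos : 1 ≤ N := by omega
  have hdsum : ∑ j ∈ Finset.range (2 * N), d (j : ZMod n) = 0 := by
    rw [← hN]
    have h1 : ∑ j ∈ Finset.range n, d (j : ZMod n) = ∑ j : ZMod n, d j := by
      refine Finset.sum_bij' (fun j _ => (j : ZMod n)) (fun j _ => j.val) ?_ ?_ ?_ ?_ ?_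
      · simp
      · exact fun j _ => Finset.mem_range.2 (ZMod.val_lt j)
      · exact fun j hj => ZMod.val_cast_of_lt (Finset.mem_range.1 hj)
      · exact fun j _ => ZMod.natCast_zmod_val j
      · exact fun _ _ => rfl
    rw [h1, Finset.sum_sub_distrib, ← Nat.cast_sum, ← Nat.cast_sum, hsum, sub_self]
  -- At the smallest `y`-variable where they differ, the smaller exponent `b` has the larger entry.
  -- As `y_0` is the smallest variable of all, index `0` is the separate first case.
  have hlast : d ((0 : ℕ) : ZMod n) < 0 ∨ d ((0 : ℕ) : ZMod n) = 0 ∧ ∃ l : ℕ, l < 2 * N ∧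
      d (l : ZMod n) < 0 ∧ ∀ j : ℕ, l < j → j < 2 * N → d (j : ZMod n) = 0 := by
    rcases (hm b a).1 hba with h1 | ⟨h1, h2⟩
    · rcases (hm₁ _ _).1 h1 with h1 | ⟨-, i, hi, hij⟩
      · rw [degree_yPart, degree_yPart, hsum] at h1
        exact absurd h1 (lt_irrefl _)
      · simp only [yPart_apply] at hi hij
        have hneg : d i < 0 := by simp only [d]; omega
        have hzero : ∀ j, rep i < rep j → d j = 0 := fun j hj => by
          have := hij j hj
          simp only [d]; omega
        rcases (rep_le i).lt_or_eq with hlt | heq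
        · refine Or.inr ⟨hzero _ (by simpa [rep] using hlt), rep i, by omega, ?_, ?_⟩
          · rwa [natCast_rep]
          · intro j hj hj'
            have := one_le_rep i
            refine hzero _ ?_
            rwa [rep_natCast (by omega) (by omega)]
        · left
          have := natCast_rep i
          rw [heq, ZMod.natCast_self] at this
          rwa [Nat.cast_zero, this]
    -- Equal `y`-parts make `d` vanish, hence the `x`-parts agree too. So `<_2` never decides a
    -- comparison inside a fiber and may be arbitrary.
    · exfalso
      have hy : ∀ j, d j = 0 := fun j => by
        have := DFunLike.congr_fun h1 j
        rw [yPart_apply, yPart_apply] at this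
        simp only [d]; omega
      have : xPart b = xPart a := by
        ext i
        have := hx i
        rw [hy, hy] at this
        rw [xPart_apply, xPart_apply]
        omega
      rw [this] at h2
      exact lt_irrefl _ h2
  obtain ⟨k, hk, hpos, hend⟩ := exists_alternating_block hNpos (c := fun j => d (j : ZMod n)) hdsum
    (fun j hj => hf j (by omega)) hlast
  have hstep : stepExp n (k + 1) 1 ≤ a :=
    stepExp_le (by omega) fun i hi => hd _ (hpos i (by omega))
  rcases hend with rfl | ⟨hk', hlt⟩
  · exact Or.inr hstep
  -- The inequality `d_{2k+1} + d_{2k+2} > 0` that ends the block supplies the factor `x_{2k}` of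
  -- the leading term of `g_{k+1}`.
  · refine Or.inl ⟨k + 1, by omega, hk'.le, single_inl_add_le (hxpos _ ?_) hstep
      (stepExp_inl _ _ _ _)⟩
    push_cast at hlt ⊢
    convert hlt using 3 <;> ring

end LeadingTerms

end CyclePath

/-! ### The Gröbner basis -/

theorem mainTheorem11 {K : Type*} [Field K] (n : ℕ) [NeZero n] (hn : 4 ≤ n) (hn_even : Even n)
    (m₁ m₂ : MonomialOrder (ZMod n)) (m : MonomialOrder (ZMod n ⊕ ZMod n))
    (hm₁ : CyclePath.IsRevLex CyclePath.varLT m₁)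
    (hm : CyclePath.IsProductOrder m m₁ m₂) :
    CyclePath.IsGroebnerBasis m
      ({p | ∃ j, 1 ≤ j ∧ j ≤ n - 1 ∧ p = CyclePath.f K n j} ∪
        {p | ∃ k, 1 ≤ k ∧ k ≤ n / 2 ∧ p = CyclePath.g K n k} ∪
        {CyclePath.h K n})
      (CyclePath.symDefiningIdeal (CyclePath.pathMonomial K n (n - 2)) ⊔
        CyclePath.extendToT (CyclePath.fiberRelations (CyclePath.pathMonomial K n (n - 2)))) := by
  obtain ⟨N, hN⟩ := id hn_even
  rw [← two_mul] at hN
  have hN2 : n / 2 = N := by omega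
  have hmem : ∀ p ∈ ({p | ∃ j, 1 ≤ j ∧ j ≤ n - 1 ∧ p = CyclePath.f K n j} ∪
        {p | ∃ k, 1 ≤ k ∧ k ≤ n / 2 ∧ p = CyclePath.g K n k} ∪
        {CyclePath.h K n} : Set (MvPolynomial (ZMod n ⊕ ZMod n) K)),
      p ∈ CyclePath.symDefiningIdeal (CyclePath.pathMonomial K n (n - 2)) ⊔
        CyclePath.extendToT (CyclePath.fiberRelations (CyclePath.pathMonomial K n (n - 2))) := by
    rintro p ((⟨j, -, -, rfl⟩ | ⟨k, hk, -, rfl⟩) | rfl)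
    · exact Ideal.mem_sup_left (CyclePath.f_mem K (by omega) j)
    · obtain ⟨k, rfl⟩ : ∃ l, k = l + 1 := ⟨k - 1, by omega⟩
      exact Ideal.mem_sup_left (CyclePath.g_mem K (by omega) k)
    · exact Ideal.mem_sup_right (CyclePath.h_mem K (by omega) hn_even)
  refine ⟨?_, hmem, ?_, le_antisymm (Ideal.span_mono ?_) (Ideal.span_le.2 ?_)⟩
  · refine Set.Finite.union (Set.Finite.union ?_ ?_) (Set.finite_singleton _)
    · refine ((Set.finite_Icc 1 (n - 1)).image (CyclePath.f K n)).subset ?_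
      rintro _ ⟨j, h1, h2, rfl⟩
      exact ⟨j, ⟨h1, h2⟩, rfl⟩
    · refine ((Set.finite_Icc 1 (n / 2)).image (CyclePath.g K n)).subset ?_
      rintro _ ⟨j, h1, h2, rfl⟩
      exact ⟨j, ⟨h1, h2⟩, rfl⟩
  · have hne : ∀ p : MvPolynomial (ZMod n ⊕ ZMod n) K, m.leadingCoeff p = 1 → p ≠ 0 := by
      rintro _ h rfl
      simp at h
    rintro p ((⟨j, h1, h2, rfl⟩ | ⟨k, h1, h2, rfl⟩) | rfl)
    · exact hne _ (CyclePath.degree_f hm₁ hm h1 h2).2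
    · exact hne _ (CyclePath.degree_g hm₁ hm h1 (by omega)).2
    · exact hne _ (CyclePath.degree_h hm₁ hm (by omega) hN).2
  · rintro _ ⟨p, hp, rfl⟩
    exact ⟨p, hmem p hp, rfl⟩
  · rintro _ ⟨p, hp, rfl⟩
    by_cases hp0 : p = 0
    · rw [hp0, MonomialOrder.leadingTerm_zero]
      exact zero_mem _
    obtain ⟨b, hb, hD⟩ := CyclePath.exists_lt_degree_of_aeval_eq_zero m (CyclePath.reesExp n) hp0
      (CyclePath.sup_le_ker_reesMap K n hp)
    rcases CyclePath.exists_le_of_lt_of_fiber hm₁ hm (by omega) hN hb hD with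
      ⟨j, h1, h2, hle⟩ | ⟨k, h1, h2, hle⟩ | hle
    · have hdeg := CyclePath.degree_f (K := K) hm₁ hm h1 h2
      exact CyclePath.leadingTerm_mem_span_of_le m (Or.inl (Or.inl ⟨j, h1, h2, rfl⟩)) hdeg.2
        (hdeg.1.trans_le hle)
    · have hdeg := CyclePath.degree_g (K := K) hm₁ hm h1 (show 2 * k ≤ n by omega)
      exact CyclePath.leadingTerm_mem_span_of_le m
        (Or.inl (Or.inr ⟨k, h1, by omega, rfl⟩)) hdeg.2 (hdeg.1.trans_le hle)
    · have hdeg := CyclePath.degree_h (K := K) hm₁ hm (by omega) hN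
      exact CyclePath.leadingTerm_mem_span_of_le m (Or.inr rfl) hdeg.2 (hdeg.1.trans_le hle)
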